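/- Let $M$ be a compact Hausdorff space and $f\colon M\to M$ a homeomorphism such that the only clopen sets $S\subset M$ with $f^{-1}(S)=S$ are $\emptyset$ and $M$ (for instance, $M$ connected or $f$ topologically transitive). Let $X$ be a real or complex Banach space, $B(X)$ the bounded operators on $X$ with the operator norm, and $\mathcal A\colon M\times\mathbb N_0\to B(X)$ a cocycle over $f$: $\mathcal A(q,0)=\mathrm{Id}$, $\mathcal A(q,n+m)=\mathcal A(f^n(q),m)\mathcal A(q,n)$, and $q\mapsto A(q):=\mathcal A(q,1)$ is continuous. A cocycle $\mathcal A$ is uniformly hyperbolic if there are projections $P(q)\in B(X)$, depending continuously on $q\in M$, with $A(q)P(q)=P(f(q))A(q)$ and $A(q)|_{\operatorname{Ker}P(q)}\colon \operatorname{Ker}P(q)\to\operatorname{Ker}P(f(q))$ invertible, and constants $D,\lambda>0$ such that $\|\mathcal A(q,n)P(q)\|\le De^{-\lambda n}$ and $\|\mathcal A(q,-n)(\mathrm{Id}-P(q))\|\le De^{-\lambda n}$ for all $q\in M$, $n\ge 0$, where $\mathcal A(q,-n)=(\mathcal A(f^{-n}(q),n)|_{\operatorname{Ker}P(f^{-n}(q))})^{-1}$.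 For $B\in B(X)$ let $\|B\|_{ic}$ be the infimum of the $r>0$ such that the image under $B$ of the closed unit ball is covered by finitely many balls of radius $r$. For an ergodic $f$-invariant Borel probability measure $\mu$, let $\lambda(\mu),\kappa(\mu)\in[-\infty,\infty)$ be the $\mu$-almost everywhere constant values of $\lim_{n}\frac1n\log\|\mathcal A(q,n)\|$ and $\lim_{n}\frac1n\log\|\mathcal A(q,n)\|_{ic}$. Assume that $\mathcal A$ is quasicompact with respect to every such $\mu$, that is, $\kappa(\mu)<\lambda(\mu)$. Put $\kappa=\sup_\mu\kappa(\mu)\in[-\infty,\infty)$, the supremum being over all such $\mu$, and $\mathcal A_a(q,n)=e^{-an}\mathcal A(q,n)$ for $a\in\mathbb R$. The Sacker–Sell spectrum is $$\Sigma=\{a\in\mathbb R: a>\kappa\text{ and }\mathcal A_a\text{ is not uniformly hyperbolic}\}\subset(\kappa,\infty).$$ Then exactly one of the following alternatives holds: 1. $\Sigma=\emptyset$; 2. $\Sigma=\bigcup_{n=1}^k[a_n,b_n]$ for some $k\ge1$ and real numbers $b_1\ge a_1>b_2\ge a_2>\cdots>b_k\ge a_k>\kappa$; 3. $\Sigma=\bigcup_{n=1}^{k-1}[a_n,b_n]\cup(\kappa,b_k]$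 for some $k\ge1$ and real numbers $a_n,b_n$ as in 2; 4. $\Sigma=\bigcup_{n=1}^\infty[a_n,b_n]$ for some real numbers $b_1\ge a_1>b_2\ge a_2>\cdots$ with $\lim_{n\to\infty}a_n=\kappa$; 5. $\Sigma=\bigcup_{n=1}^\infty[a_n,b_n]\cup(\kappa,b_\infty]$ for some real numbers $b_1\ge a_1>b_2\ge a_2>\cdots$ with $b_\infty:=\lim_{n\to\infty}a_n>\kappa$. -/

import Mathlib

open Set Filter Topology MeasureTheory

noncomputable section

namespace SackerSell

section Cocycles

variable {M 𝕜 X : Type*} [TopologicalSpace M] [RCLike 𝕜] [NormedAddCommGroup X] [NormedSpace 𝕜 X]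

/-- `𝒜 : M × ℕ → B(X)` is a (one-sided, norm continuous) cocycle over the homeomorphism `f`. -/
structure IsCocycle (f : M ≃ₜ M) (𝒜 : M → ℕ → X →L[𝕜] X) : Prop where
  map_zero : ∀ q, 𝒜 q 0 = ContinuousLinearMap.id 𝕜 X
  map_add : ∀ q n m, 𝒜 q (n + m) = (𝒜 (f^[n] q) m).comp (𝒜 q n)
  continuous_generator : Continuous fun q => 𝒜 q 1

/-- `𝒜(q, -n) = (𝒜(f⁻ⁿ q, n) | Ker P(f⁻ⁿ q))⁻¹`, the inverse of the map
`𝒜(f⁻ⁿ q, n) : Ker P(f⁻ⁿ q) → Ker P(q)`; only used at points of `Ker P(q)` and when that map is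
bijective. -/
def backward (f : M ≃ₜ M) (𝒜 : M → ℕ → X →L[𝕜] X) (P : M → X →L[𝕜] X) (q : M) (n : ℕ) : X → X :=
  Function.invFunOn (𝒜 (f.symm^[n] q) n) {x | P (f.symm^[n] q) x = 0}

/-- Uniform hyperbolicity of a cocycle. The last condition is the bound
`‖𝒜(q, -n) (Id - P(q))‖ ≤ D e^{-λ n}` on the operator norm. -/
def UniformlyHyperbolic (f : M ≃ₜ M) (𝒜 : M → ℕ → X →L[𝕜] X) : Prop :=
  ∃ P : M → X →L[𝕜] X,
    (∀ q, (P q).comp (P q) = P q) ∧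
    (∀ q, (𝒜 q 1).comp (P q) = (P (f q)).comp (𝒜 q 1)) ∧
    (∀ q, BijOn (𝒜 q 1) {x | P q x = 0} {x | P (f q) x = 0}) ∧
    Continuous P ∧
    ∃ D l : ℝ, 0 < D ∧ 0 < l ∧ ∀ (q : M) (n : ℕ),
      ‖(𝒜 q n).comp (P q)‖ ≤ D * Real.exp (-l * n) ∧
      ∀ x : X, ‖backward f 𝒜 P q n (x - P q x)‖ ≤ D * Real.exp (-l * n) * ‖x‖

/-- The rescaled cocycle `𝒜ₐ(q, n) = e^{-a n} 𝒜(q, n)`. -/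
def rescale (𝒜 : M → ℕ → X →L[𝕜] X) (a : ℝ) : M → ℕ → X →L[𝕜] X :=
  fun q n => ((Real.exp (-a * n) : ℝ) : 𝕜) • 𝒜 q n

/-- `‖A‖_{ic(X)}`: the infimum of all `r > 0` such that the image of the closed unit ball is covered
by finitely many balls of radius `r`. -/
def icNorm (A : X →L[𝕜] X) : ℝ :=
  sInf {r : ℝ | 0 < r ∧ ∃ t : Finset X, A '' Metric.closedBall 0 1 ⊆ ⋃ x ∈ t, Metric.ball x r}

end Cocycles

section Exponents

variable {M : Type*} [MeasurableSpace M]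

/-- For `F n q ≥ 0`, the `μ`-almost everywhere value, in `[-∞, ∞]`, of
`lim (1/n) log F n q`. It is written with `limsup` and `essSup` so that it is defined
unconditionally. -/
def growthRate (μ : Measure M) (F : ℕ → M → ℝ) : EReal :=
  essSup (fun q => limsup (fun n : ℕ => ENNReal.log (ENNReal.ofReal (F n q)) / (n : EReal)) atTop) μ

/-- Whenever `(1/n) log F n q` converges to the same number `c` for almost every `q`, that number is
the growth rate. -/
theorem growthRate_eq_of_tendsto (μ : Measure M) [IsProbabilityMeasure μ] (F : ℕ → M → ℝ)
    (c : EReal) (h : ∀ᵐ q ∂μ, Tendsto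
      (fun n : ℕ => ENNReal.log (ENNReal.ofReal (F n q)) / (n : EReal)) atTop (𝓝 c)) :
    growthRate μ F = c := by
  unfold growthRate
  rw [essSup_congr_ae (g := fun _ => c) (h.mono fun q hq => hq.limsup_eq)]
  exact essSup_const c (IsProbabilityMeasure.ne_zero μ)

variable {𝕜 X : Type*} [TopologicalSpace M] [RCLike 𝕜] [NormedAddCommGroup X] [NormedSpace 𝕜 X]

/-- The set of ergodic `f`-invariant probability measures. -/
def ergodicMeasures (f : M ≃ₜ M) : Set (Measure M) :=
  {μ | IsProbabilityMeasure μ ∧ Ergodic f μ}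

/-- `λ(μ)`, the almost everywhere value of `lim (1/n) log ‖𝒜(q, n)‖`. -/
def topExponent (𝒜 : M → ℕ → X →L[𝕜] X) (μ : Measure M) : EReal :=
  growthRate μ fun n q => ‖𝒜 q n‖

/-- `κ(μ)`, the almost everywhere value of `lim (1/n) log ‖𝒜(q, n)‖_{ic(X)}`. -/
def icExponent (𝒜 : M → ℕ → X →L[𝕜] X) (μ : Measure M) : EReal :=
  growthRate μ fun n q => icNorm (𝒜 q n)

/-- Quasicompactness of a cocycle with respect to `μ`. -/
def Quasicompact (𝒜 : M → ℕ → X →L[𝕜] X) (μ : Measure M) : Prop :=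
  icExponent 𝒜 μ < topExponent 𝒜 μ

/-- `κ`, the maximum (written as a supremum) of `κ(μ)` over all ergodic invariant `μ`. -/
def kappa (f : M ≃ₜ M) (𝒜 : M → ℕ → X →L[𝕜] X) : EReal :=
  ⨆ μ ∈ ergodicMeasures f, icExponent 𝒜 μ

/-- The Sacker--Sell spectrum `Σ ⊆ (κ, ∞)`. -/
def spectrum (f : M ≃ₜ M) (𝒜 : M → ℕ → X →L[𝕜] X) : Set ℝ :=
  {a : ℝ | kappa f 𝒜 < a ∧ ¬ UniformlyHyperbolic f (rescale 𝒜 a)}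

end Exponents

/-- There is no nontrivial clopen set that is invariant under `f`. This holds if `M` is connected,
and also if `f` is topologically transitive. -/
def InvariantlyConnected {M : Type*} [TopologicalSpace M] (f : M ≃ₜ M) : Prop :=
  ∀ S : Set M, IsClopen S → f ⁻¹' S = S → S = ∅ ∨ S = univ

/-- `b 1 ≥ a 1 > b 2 ≥ a 2 > ⋯ > b k ≥ a k > κ`, with `k ≥ 1`. -/
def FiniteChain (κ : EReal) (k : ℕ) (a b : ℕ → ℝ) : Prop :=
  1 ≤ k ∧ (∀ n ∈ Icc 1 k, a n ≤ b n) ∧ (∀ n ∈ Ico 1 k, b (n + 1) < a n) ∧ κ < a k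

/-- `b 1 ≥ a 1 > b 2 ≥ a 2 > ⋯`. -/
def InfiniteChain (a b : ℕ → ℝ) : Prop :=
  ∀ n, 1 ≤ n → a n ≤ b n ∧ b (n + 1) < a n

/-- The five possible forms of a subset `S` of `(κ, ∞)`. -/
def HasForm (κ : EReal) (S : Set ℝ) : Fin 5 → Prop
  | 0 => S = ∅
  | 1 => ∃ (k : ℕ) (a b : ℕ → ℝ), FiniteChain κ k a b ∧ S = ⋃ n ∈ Icc 1 k, Icc (a n) (b n)
  | 2 => ∃ (k : ℕ) (a b : ℕ → ℝ), FiniteChain κ k a b ∧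
      S = (⋃ n ∈ Ico 1 k, Icc (a n) (b n)) ∪ {x : ℝ | κ < x ∧ x ≤ b k}
  | 3 => ∃ a b : ℕ → ℝ, InfiniteChain a b ∧ Tendsto (fun n => (a n : EReal)) atTop (𝓝 κ) ∧
      S = ⋃ n ∈ Ici 1, Icc (a n) (b n)
  | 4 => ∃ (a b : ℕ → ℝ) (b_inf : ℝ), InfiniteChain a b ∧ Tendsto a atTop (𝓝 b_inf) ∧
      κ < b_inf ∧ S = (⋃ n ∈ Ici 1, Icc (a n) (b n)) ∪ {x : ℝ | κ < x ∧ x ≤ b_inf}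

end SackerSell

end

/-! A point `a > κ` outside `Σ` carries a dichotomy with rates `a - l < a < a + l`. The same
splitting serves every nearby exponent, so `Σ` is relatively closed in `(κ, ∞)`; it is bounded above
because a large rescaling contracts everything.

The counting device is the dimension `d(a)` of the unstable spaces `Ker P_a(q)`. It does not depend
on `q`: rank is locally constant in a continuous family of projections and invariant under `f`, so
invariant connectedness applies (`Dichotomy.rank_ker_eq`). It is finite: uniform expansion at a rate
`β > κ` on infinite-dimensional spaces would force `κ(μ) ≥ β` for every ergodic `μ`, and such a `μ`
exists (`ergodicMeasures_nonempty`, `Dichotomy.finiteDimensional_ker`). For resolvent points `x < y`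
the unstable space of `y` lies in that of `x` (`Dichotomy.ker_le`), so `d(y) ≤ d(x)`. If the
dimensions agree, the splittings have the same unstable spaces, and one splitting has the stable
rate of `x` and the unstable rate of `y`, so `[x, y]` misses `Σ` (`Dichotomy.join`).

Hence `d` strictly increases each time a piece of `Σ` is crossed from right to left. Above any
resolvent point there are only finitely many pieces, so they can be listed downwards
(`exists_next_interval`, `exists_hasForm`). The list stops, or accumulates at `κ`, or accumulates at
some `b_∞ > κ` below which no resolvent point can remain. -/

noncomputable section

namespace SackerSell

/-! ### Existence of an ergodic measure on a compact Hausdorff space -/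

section ErgodicMeasures

variable {M : Type*} [TopologicalSpace M]

/-- Normalized positive linear functionals on `C(M, ℝ)` that are invariant under `f`, as a subset
of the product space `C(M, ℝ) → ℝ`. -/
def invariantStates (f : M ≃ₜ M) : Set (C(M, ℝ) → ℝ) :=
  {φ | (∀ g h, φ (g + h) = φ g + φ h) ∧ (∀ (c : ℝ) g, φ (c • g) = c * φ g) ∧
    (∀ g, 0 ≤ g → 0 ≤ φ g) ∧ φ 1 = 1 ∧ ∀ g : C(M, ℝ), φ (g.comp ⟨f, f.continuous⟩) = φ g}

theorem isClosed_invariantStates (f : M ≃ₜ M) : IsClosed (invariantStates f) := by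
  simp only [invariantStates, ofPred_and, ofPred_forall]
  refine IsClosed.inter ?_ (IsClosed.inter ?_ (IsClosed.inter ?_ (IsClosed.inter ?_ ?_)))
  · exact isClosed_iInter fun g => isClosed_iInter fun h =>
      isClosed_eq (by fun_prop) (by fun_prop)
  · exact isClosed_iInter fun c => isClosed_iInter fun g =>
      isClosed_eq (by fun_prop) (by fun_prop)
  · exact isClosed_iInter fun g => isClosed_iInter fun _ => isClosed_le (by fun_prop) (by fun_prop)
  · exact isClosed_eq (by fun_prop) (by fun_prop)
  · exact isClosed_iInter fun g => isClosed_eq (by fun_prop) (by fun_prop)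

variable [CompactSpace M]

theorem abs_le_norm_of_mem_invariantStates {f : M ≃ₜ M} {φ : C(M, ℝ) → ℝ}
    (hφ : φ ∈ invariantStates f) (g : C(M, ℝ)) : |φ g| ≤ ‖g‖ := by
  obtain ⟨hadd, hsmul, hpos, hone, -⟩ := hφ
  have key : ∀ c : ℝ, φ (‖g‖ • 1 + c • g) = ‖g‖ + c * φ g := fun c => by
    rw [hadd, hsmul, hsmul, hone, mul_one]
  have h1 : 0 ≤ φ (‖g‖ • 1 + (1 : ℝ) • g) := hpos _ fun x => by
    have := (abs_le.mp (g.norm_coe_le_norm x)).1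
    simp; linarith
  have h2 : 0 ≤ φ (‖g‖ • 1 + (-1 : ℝ) • g) := hpos _ fun x => by
    have := (abs_le.mp (g.norm_coe_le_norm x)).2
    simp; linarith
  rw [key] at h1 h2
  rw [abs_le]
  constructor <;> linarith

theorem isCompact_invariantStates (f : M ≃ₜ M) : IsCompact (invariantStates f) := by
  refine (isCompact_univ_pi fun g : C(M, ℝ) => isCompact_Icc (a := -‖g‖) (b := ‖g‖)).of_isClosed_subset
    (isClosed_invariantStates f) fun φ hφ g _ => ?_
  exact abs_le.mp (abs_le_norm_of_mem_invariantStates hφ g)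

/-- Krylov–Bogolyubov: Birkhoff averages along one orbit, with the limit taken along an ultrafilter
because the product space need not be sequentially compact. -/
theorem invariantStates_nonempty [Nonempty M] (f : M ≃ₜ M) : (invariantStates f).Nonempty := by
  obtain ⟨q⟩ := ‹Nonempty M›
  let A : ℕ → C(M, ℝ) → ℝ := fun n g => ((n : ℝ) + 1)⁻¹ * ∑ i ∈ Finset.range (n + 1), g (f^[i] q)
  have hA : ∀ n g, A n g ∈ Icc (-‖g‖) ‖g‖ := fun n g => by
    have hn : (0 : ℝ) < (n : ℝ) + 1 := by positivity
    rw [mem_Icc, ← abs_le, abs_mul, abs_of_pos (inv_pos.mpr hn), inv_mul_le_iff₀ hn]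
    refine (Finset.abs_sum_le_sum_abs _ _).trans ?_
    refine (Finset.sum_le_sum fun i _ => g.norm_coe_le_norm (f^[i] q)).trans ?_
    simp
  have hA' : ∀ n, A n ∈ univ.pi fun g : C(M, ℝ) => Icc (-‖g‖) ‖g‖ := fun n g _ => hA n g
  obtain ⟨φ, -, hφ⟩ := (isCompact_univ_pi fun g : C(M, ℝ) =>
    isCompact_Icc (a := -‖g‖) (b := ‖g‖)).ultrafilter_le_nhds
      ((hyperfilter ℕ).map A) (le_principal_iff.mpr (Ultrafilter.mem_map.mpr (Filter.univ_mem' hA')))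
  have hlim : ∀ g, Tendsto (fun n => A n g) (hyperfilter ℕ : Filter ℕ) (𝓝 (φ g)) := fun g =>
    (tendsto_pi_nhds.mp (show Tendsto A (hyperfilter ℕ : Filter ℕ) (𝓝 φ) from hφ)) g
  refine ⟨φ, fun g h => ?_, fun c g => ?_, fun g hg => ?_, ?_, fun g => ?_⟩
  · refine tendsto_nhds_unique (hlim _) (((hlim g).add (hlim h)).congr fun n => ?_)
    simp [A, Finset.sum_add_distrib, mul_add]
  · refine tendsto_nhds_unique (hlim _) (((hlim g).const_mul c).congr fun n => ?_)
    simp [A, ← Finset.mul_sum, mul_left_comm]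
  · refine ge_of_tendsto' (hlim g) fun n => ?_
    exact mul_nonneg (by positivity) (Finset.sum_nonneg fun i _ => hg _)
  · refine tendsto_nhds_unique (hlim _) (tendsto_const_nhds.congr fun n => ?_)
    have hn : (n : ℝ) + 1 ≠ 0 := by positivity
    simp [A, hn]
  · refine tendsto_nhds_unique (hlim _) ?_
    -- The averages of `g ∘ f` and `g` differ by a telescoping sum: only the two end terms survive,
    -- divided by `n + 1`.
    have h0 : Tendsto (fun n : ℕ => ((n : ℝ) + 1)⁻¹ * (g (f^[n + 1] q) - g q))
        (hyperfilter ℕ : Filter ℕ) (𝓝 0) := by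
      have h1 : Tendsto (fun n : ℕ => ((n : ℝ) + 1)⁻¹ * (‖g‖ + ‖g‖)) atTop (𝓝 0) := by
        simpa using (tendsto_one_div_add_atTop_nhds_zero_nat (𝕜 := ℝ)).mul_const (‖g‖ + ‖g‖)
      refine (squeeze_zero_norm (fun n => ?_) h1).mono_left Nat.hyperfilter_le_atTop
      have hn : (0 : ℝ) < (n : ℝ) + 1 := by positivity
      rw [norm_mul, Real.norm_of_nonneg (inv_pos.mpr hn).le]
      gcongr
      exact (norm_sub_le _ _).trans (add_le_add (g.norm_coe_le_norm _) (g.norm_coe_le_norm _))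
    refine (add_zero (φ g) ▸ (hlim g).add h0).congr fun n => ?_
    simp only [A, ContinuousMap.comp_apply, ContinuousMap.coe_mk, ← mul_add]
    congr 1
    have h2 := Finset.sum_range_succ (fun i => g (f^[i] q)) (n + 1)
    rw [Finset.sum_range_succ' (fun i => g (f^[i] q)) (n + 1)] at h2
    simp only [Function.iterate_succ_apply', Function.iterate_zero, id] at h2 ⊢
    linarith

variable [T2Space M] [MeasurableSpace M] [BorelSpace M]

omit [T2Space M] in
theorem integral_mem_invariantStates {f : M ≃ₜ M} {μ : Measure M} [IsProbabilityMeasure μ]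
    (hμ : MeasurePreserving f μ μ) : (fun g : C(M, ℝ) => ∫ x, g x ∂μ) ∈ invariantStates f := by
  have hint : ∀ g : C(M, ℝ), Integrable g μ := fun g =>
    g.continuous.integrable_of_hasCompactSupport (HasCompactSupport.of_compactSpace g)
  refine ⟨fun g h => ?_, fun c g => ?_, fun g hg => ?_, ?_, fun g => ?_⟩
  · exact integral_add (hint g) (hint h)
  · exact integral_const_mul c g
  · exact integral_nonneg hg
  · simp
  · exact hμ.integral_comp f.measurableEmbedding g

/-- Riesz–Markov. Regularity is recorded because `M` need not be metrizable: only among regular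
measures do integrals of continuous functions determine the measure. This also gives invariance, as
`μ.map f` is regular with the same integrals. -/
theorem exists_regular_of_mem_invariantStates {f : M ≃ₜ M} {φ : C(M, ℝ) → ℝ}
    (hφ : φ ∈ invariantStates f) : ∃ μ : Measure M, μ.Regular ∧ IsProbabilityMeasure μ ∧
      MeasurePreserving f μ μ ∧ ∀ g : C(M, ℝ), ∫ x, g x ∂μ = φ g := by
  obtain ⟨hadd, hsmul, hpos, hone, hinv⟩ := hφ
  let Λ : CompactlySupportedContinuousMap M ℝ →ₚ[ℝ] ℝ := PositiveLinearMap.mk₀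
    { toFun := fun g => φ g.toContinuousMap
      map_add' := fun g h => hadd _ _
      map_smul' := fun c g => hsmul c _ } fun g hg => hpos _ hg
  have hΛ : ∀ g : C(M, ℝ), ∫ x, g x ∂(RealRMK.rieszMeasure Λ) = φ g := fun g =>
    RealRMK.integral_rieszMeasure Λ ⟨g, HasCompactSupport.of_compactSpace g⟩
  have hreg : (RealRMK.rieszMeasure Λ).Regular := inferInstance
  generalize RealRMK.rieszMeasure Λ = μ at hΛ hreg
  have hfin : IsFiniteMeasure μ := inferInstance
  refine ⟨μ, hreg, ⟨?_⟩, ⟨f.measurable, ?_⟩, hΛ⟩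
  · have h1 := hΛ 1
    rw [hone] at h1
    simp only [ContinuousMap.one_apply, integral_const, smul_eq_mul, mul_one] at h1
    rw [← ENNReal.toReal_eq_one_iff]; exact h1
  · have : (μ.map f).Regular := Measure.Regular.map f
    refine Measure.ext_of_integral_eq_on_compactlySupported fun g => ?_
    rw [f.measurableEmbedding.integral_map]
    have h2 := hΛ (g.toContinuousMap.comp ⟨f, f.continuous⟩)
    rw [hinv] at h2
    exact h2.trans (hΛ g.toContinuousMap).symm

/-- An extreme invariant state is ergodic: an invariant set of intermediate measure would write it
as a proper convex combination of two conditional measures. -/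
theorem ergodicMeasures_nonempty [Nonempty M] (f : M ≃ₜ M) : (ergodicMeasures f).Nonempty := by
  obtain ⟨φ, hφ⟩ := (isCompact_invariantStates f).extremePoints_nonempty
    (invariantStates_nonempty f)
  obtain ⟨μ, hreg, hprob, hinv, hint⟩ := exists_regular_of_mem_invariantStates hφ.1
  refine ⟨μ, hprob, hinv, ⟨fun s hs hfs => ?_⟩⟩
  by_contra H
  obtain ⟨h0, h0'⟩ : μ s ≠ 0 ∧ μ sᶜ ≠ 0 := by
    simpa [eventuallyConst_set, ae_iff, and_comm] using! H
  have hcond : ∀ {t : Set M}, MeasurableSet t → f ⁻¹' t = t → μ t ≠ 0 →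
      (fun g : C(M, ℝ) => ∫ x, g x ∂(ProbabilityTheory.cond μ t)) ∈ invariantStates f := by
    intro t ht hft hμt
    have := ProbabilityTheory.cond_isProbabilityMeasure hμt
    refine integral_mem_invariantStates (.smul_measure ?_ _)
    convert! hinv.restrict_preimage ht
    exact hft.symm
  have hsplit : ∀ g : C(M, ℝ), μ.real s * ∫ x, g x ∂(ProbabilityTheory.cond μ s) +
      μ.real sᶜ * ∫ x, g x ∂(ProbabilityTheory.cond μ sᶜ) = φ g := by
    intro g
    have hg : Integrable g μ :=
      g.continuous.integrable_of_hasCompactSupport (HasCompactSupport.of_compactSpace g)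
    have e1 : μ.real s ≠ 0 := (measureReal_ne_zero_iff).mpr h0
    have e2 : μ.real sᶜ ≠ 0 := (measureReal_ne_zero_iff).mpr h0'
    rw [← hint g, ← integral_add_compl hs hg, ProbabilityTheory.cond, ProbabilityTheory.cond,
      integral_smul_measure, integral_smul_measure, ENNReal.toReal_inv, ENNReal.toReal_inv]
    simp only [smul_eq_mul, ← measureReal_def]
    rw [mul_inv_cancel_left₀ e1, mul_inv_cancel_left₀ e2]
  have heq : (fun g : C(M, ℝ) => ∫ x, g x ∂(ProbabilityTheory.cond μ s)) = φ := by
    refine hφ.2 (hcond hs hfs h0) (hcond hs.compl (by rw [preimage_compl, hfs]) h0') ?_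
    refine ⟨μ.real s, μ.real sᶜ, ?_, ?_, ?_, funext hsplit⟩
    · exact ENNReal.toReal_pos h0 (measure_ne_top _ _)
    · exact ENNReal.toReal_pos h0' (measure_ne_top _ _)
    · rw [measureReal_add_measureReal_compl hs]; simp
  have hregs : (ProbabilityTheory.cond μ s).Regular := by
    have : (μ.restrict s).Regular := Measure.Regular.restrict_of_measure_ne_top (measure_ne_top _ _)
    exact Measure.Regular.smul (ENNReal.inv_ne_top.mpr h0)
  have := ProbabilityTheory.cond_isProbabilityMeasure h0
  have hμs : ProbabilityTheory.cond μ s = μ :=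
    Measure.ext_of_integral_eq_on_compactlySupported fun g =>
      (congrFun heq g.toContinuousMap).trans (hint _).symm
  -- Conditioning on `s` gives `sᶜ` measure zero, against `h0'`.
  rw [← hμs] at h0'
  simp [ProbabilityTheory.cond_apply, hs] at h0'

end ErgodicMeasures

/-! ### The five forms exclude each other -/

section Forms

variable {κ : EReal} {S : Set ℝ}

theorem lt_of_chain {a b : ℕ → ℝ} {k : ℕ} (hab : ∀ n ∈ Icc 1 k, a n ≤ b n)
    (hba : ∀ n ∈ Ico 1 k, b (n + 1) < a n) {m n : ℕ} (hm : 1 ≤ m) (hmn : m < n) (hn : n ≤ k) :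
    b n < a m := by
  induction n, hmn using Nat.le_induction with
  | base => exact hba m ⟨hm, hn⟩
  | succ n hmn ih =>
    have hmn' : m < n := hmn
    exact (hba n ⟨by omega, hn⟩).trans ((hab n ⟨by omega, by omega⟩).trans_lt (ih (by omega)))

theorem InfiniteChain.lt {a b : ℕ → ℝ} (h : InfiniteChain a b) {m n : ℕ} (hm : 1 ≤ m)
    (hmn : m < n) : b n < a m :=
  lt_of_chain (k := n) (fun i hi => (h i hi.1).1) (fun i hi => (h i hi.1).2) hm hmn le_rfl

theorem InfiniteChain.antitone {a b : ℕ → ℝ} (h : InfiniteChain a b) {m n : ℕ} (hm : 1 ≤ m)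
    (hmn : m ≤ n) : a n ≤ a m := by
  rcases hmn.eq_or_lt with rfl | hlt
  · exact le_rfl
  · exact (h n (hm.trans hmn)).1.trans (h.lt hm hlt).le

theorem InfiniteChain.notMem_Icc {a b : ℕ → ℝ} (h : InfiniteChain a b) {n : ℕ} (hn : 1 ≤ n)
    {x : ℝ} (h1 : b (n + 1) < x) (h2 : x < a n) : x ∉ ⋃ m ∈ Ici 1, Icc (a m) (b m) := by
  simp only [mem_iUnion, not_exists]
  intro m hm hx
  rcases le_or_gt m n with hmn | hmn
  · exact absurd (h.antitone hm hmn) (not_le.mpr (hx.1.trans_lt h2))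
  · rcases (Nat.succ_le_of_lt hmn).eq_or_lt with rfl | hlt
    · exact absurd hx.2 (not_le.mpr h1)
    · have := h.lt (show 1 ≤ n + 1 by omega) hlt
      have := (h (n + 1) (by omega)).1
      linarith [hx.2]

/-- The elements of `S` are bounded below by some real `c > κ`. -/
def BoundedAwayFrom (κ : EReal) (S : Set ℝ) : Prop :=
  ∃ c : ℝ, κ < c ∧ ∀ x ∈ S, c ≤ x

/-- `S` contains an initial segment `(κ, c]` of `(κ, ∞)`. -/
def ContainsInitial (κ : EReal) (S : Set ℝ) : Prop :=
  ∃ c : ℝ, κ < c ∧ ∀ x : ℝ, κ < x → x ≤ c → x ∈ S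

/-- `S` contains an initial segment `(κ, c]` followed by a gap. -/
def IsolatedInitial (κ : EReal) (S : Set ℝ) : Prop :=
  ∃ c : ℝ, κ < c ∧ (∀ x : ℝ, κ < x → x ≤ c → x ∈ S) ∧ ∃ d, c < d ∧ ∀ x, c < x → x < d → x ∉ S

theorem ContainsInitial.not_boundedAwayFrom (h : ContainsInitial κ S) : ¬ BoundedAwayFrom κ S := by
  rintro ⟨c', hc', h'⟩
  obtain ⟨c, hc, h⟩ := h
  obtain ⟨x, hx1, hx2⟩ := EReal.lt_iff_exists_real_btwn.mp (lt_min hc hc')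
  have h1 : x < c := EReal.coe_lt_coe_iff.mp (hx2.trans_le (min_le_left _ _))
  have h2 : x < c' := EReal.coe_lt_coe_iff.mp (hx2.trans_le (min_le_right _ _))
  exact absurd (h' x (h x hx1 h1.le)) (not_le.mpr h2)

theorem ContainsInitial.ne_empty (h : ContainsInitial κ S) : S ≠ ∅ := by
  obtain ⟨c, hc, h⟩ := h
  exact Set.Nonempty.ne_empty ⟨c, h c hc le_rfl⟩

theorem HasForm.one (h : HasForm κ S 1) : S ≠ ∅ ∧ BoundedAwayFrom κ S := by
  obtain ⟨k, a, b, ⟨hk, hab, hba, hκ⟩, rfl⟩ := h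
  constructor
  · refine Set.Nonempty.ne_empty ⟨a k, ?_⟩
    exact mem_biUnion (show k ∈ Icc 1 k from ⟨hk, le_rfl⟩) ⟨le_rfl, hab k ⟨hk, le_rfl⟩⟩
  · refine ⟨a k, hκ, fun x hx => ?_⟩
    simp only [mem_iUnion] at hx
    obtain ⟨n, hn, hx⟩ := hx
    rcases hn.2.eq_or_lt with rfl | hlt
    · exact hx.1
    · exact (hab k ⟨hk, le_rfl⟩).trans ((lt_of_chain hab hba hn.1 hlt le_rfl).le.trans hx.1)

theorem HasForm.two (h : HasForm κ S 2) : ContainsInitial κ S ∧ IsolatedInitial κ S := by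
  obtain ⟨k, a, b, ⟨hk, hab, hba, hκ⟩, rfl⟩ := h
  have hb : κ < b k := hκ.trans_le (EReal.coe_le_coe_iff.mpr (hab k ⟨hk, le_rfl⟩))
  have hsub : ∀ x : ℝ, κ < x → x ≤ b k →
      x ∈ (⋃ n ∈ Ico 1 k, Icc (a n) (b n)) ∪ {x : ℝ | κ < x ∧ x ≤ b k} :=
    fun x h1 h2 => Or.inr ⟨h1, h2⟩
  refine ⟨⟨b k, hb, hsub⟩, b k, hb, hsub, ?_⟩
  rcases hk.eq_or_lt with rfl | hk1
  · refine ⟨b 1 + 1, by linarith, fun x h1 _ hx => ?_⟩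
    rcases hx with hx | hx
    · simp at hx
    · exact absurd hx.2 (not_le.mpr h1)
  · refine ⟨a (k - 1), lt_of_chain hab hba (by omega) (by omega) le_rfl, fun x h1 h2 hx => ?_⟩
    rcases hx with hx | hx
    · simp only [mem_iUnion] at hx
      obtain ⟨n, hn, hx⟩ := hx
      rcases (Nat.le_sub_one_of_lt hn.2).eq_or_lt with rfl | hlt
      · exact absurd hx.1 (not_le.mpr h2)
      · have := lt_of_chain hab hba hn.1 hlt (Nat.sub_le _ _)
        have := hab (k - 1) ⟨by omega, Nat.sub_le _ _⟩
        linarith [hx.1]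
    · exact absurd hx.2 (not_le.mpr h1)

theorem HasForm.three (h : HasForm κ S 3) :
    S ≠ ∅ ∧ ¬ BoundedAwayFrom κ S ∧ ¬ ContainsInitial κ S := by
  obtain ⟨a, b, hch, hlim, rfl⟩ := h
  have hmem : ∀ n, 1 ≤ n → a n ∈ ⋃ n ∈ Ici 1, Icc (a n) (b n) := fun n hn =>
    mem_biUnion (show n ∈ Ici 1 from hn) ⟨le_rfl, (hch n hn).1⟩
  have hκ : ∀ n, 1 ≤ n → κ ≤ a n := fun n hn =>
    le_of_tendsto hlim (eventually_atTop.mpr ⟨n, fun m hm =>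
      EReal.coe_le_coe_iff.mpr (hch.antitone hn hm)⟩)
  have hsmall : ∀ c : ℝ, κ < c → ∃ n, 1 ≤ n ∧ a n < c := fun c hc => by
    obtain ⟨n, hn, hn1⟩ :=
      ((hlim.eventually (gt_mem_nhds hc)).and (eventually_ge_atTop 1)).exists
    exact ⟨n, hn1, EReal.coe_lt_coe_iff.mp hn⟩
  refine ⟨Set.Nonempty.ne_empty ⟨a 1, hmem 1 le_rfl⟩, ?_, ?_⟩
  · rintro ⟨c, hc, h⟩
    obtain ⟨n, hn, hlt⟩ := hsmall c hc
    exact absurd (h _ (hmem n hn)) (not_le.mpr hlt)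
  · rintro ⟨c, hc, h⟩
    obtain ⟨n, hn, hlt⟩ := hsmall c hc
    obtain ⟨x, hx1, hx2⟩ := exists_between (hch n hn).2
    refine hch.notMem_Icc hn hx1 hx2 (h x ?_ (by linarith))
    exact (hκ (n + 1) (by omega)).trans_lt
      (EReal.coe_lt_coe_iff.mpr ((hch (n + 1) (by omega)).1.trans_lt hx1))

/-- An initial segment ending below the limit `l` can be extended, one ending at `l` has intervals
arbitrarily close above it, and one ending above `l` would cover a gap. -/
theorem HasForm.four (h : HasForm κ S 4) : ContainsInitial κ S ∧ ¬ IsolatedInitial κ S := by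
  obtain ⟨a, b, l, hch, hlim, hl, rfl⟩ := h
  have hle : ∀ n, 1 ≤ n → l ≤ a n := fun n hn =>
    le_of_tendsto hlim (eventually_atTop.mpr ⟨n, fun m hm => hch.antitone hn hm⟩)
  have hlt : ∀ n, 1 ≤ n → l < a n := fun n hn =>
    (hle (n + 1) (by omega)).trans_lt ((hch (n + 1) (by omega)).1.trans_lt (hch n hn).2)
  have hsmall : ∀ c : ℝ, l < c → ∃ n, 1 ≤ n ∧ a n < c := fun c hc => by
    obtain ⟨n, hn, hn1⟩ :=
      ((hlim.eventually (gt_mem_nhds hc)).and (eventually_ge_atTop 1)).exists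
    exact ⟨n, hn1, hn⟩
  refine ⟨⟨l, hl, fun x h1 h2 => Or.inr ⟨h1, h2⟩⟩, ?_⟩
  rintro ⟨c, hc, h, d, hcd, hd⟩
  rcases lt_trichotomy c l with hcl | rfl | hcl
  · obtain ⟨x, hx1, hx2⟩ := exists_between (lt_min hcl hcd)
    exact hd x hx1 (hx2.trans_le (min_le_right _ _))
      (Or.inr ⟨hc.trans (EReal.coe_lt_coe_iff.mpr hx1), (hx2.trans_le (min_le_left _ _)).le⟩)
  · obtain ⟨n, hn, hnd⟩ := hsmall d hcd
    exact hd _ (hlt n hn) hnd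
      (Or.inl (mem_biUnion (show n ∈ Ici 1 from hn) ⟨le_rfl, (hch n hn).1⟩))
  · obtain ⟨n, hn, hnc⟩ := hsmall c hcl
    obtain ⟨x, hx1, hx2⟩ := exists_between (hch n hn).2
    have hlx : l < x := (hlt (n + 1) (by omega)).trans_le ((hch (n + 1) (by omega)).1.trans hx1.le)
    rcases h x (hl.trans (EReal.coe_lt_coe_iff.mpr hlx)) (by linarith) with hx | hx
    · exact hch.notMem_Icc hn hx1 hx2 hx
    · exact absurd hx.2 (not_le.mpr hlx)

/-- Intended reading: `E` is emptiness, `N` is `BoundedAwayFrom`, `F` is `ContainsInitial`, `G` is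
`IsolatedInitial`. These four tell all the forms apart. -/
theorem eq_of_separating_props {p : Fin 5 → Prop} {E N F G : Prop} (hFN : F → ¬ N) (hFE : F → ¬ E)
    (h0 : p 0 → E) (h1 : p 1 → ¬ E ∧ N) (h2 : p 2 → F ∧ G) (h3 : p 3 → ¬ E ∧ ¬ N ∧ ¬ F)
    (h4 : p 4 → F ∧ ¬ G) {i j : Fin 5} (hi : p i) (hj : p j) : i = j := by
  match i, j, hi, hj with
  | 0, 0, _, _ | 1, 1, _, _ | 2, 2, _, _ | 3, 3, _, _ | 4, 4, _, _ => rfl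
  | 0, 1, hi, hj | 1, 0, hj, hi => exact absurd (h0 hi) (h1 hj).1
  | 0, 2, hi, hj | 2, 0, hj, hi => exact absurd (h0 hi) (hFE (h2 hj).1)
  | 0, 3, hi, hj | 3, 0, hj, hi => exact absurd (h0 hi) (h3 hj).1
  | 0, 4, hi, hj | 4, 0, hj, hi => exact absurd (h0 hi) (hFE (h4 hj).1)
  | 1, 2, hi, hj | 2, 1, hj, hi => exact absurd (h1 hi).2 (hFN (h2 hj).1)
  | 1, 3, hi, hj | 3, 1, hj, hi => exact absurd (h1 hi).2 (h3 hj).2.1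
  | 1, 4, hi, hj | 4, 1, hj, hi => exact absurd (h1 hi).2 (hFN (h4 hj).1)
  | 2, 3, hi, hj | 3, 2, hj, hi => exact absurd (h2 hi).1 (h3 hj).2.2
  | 2, 4, hi, hj | 4, 2, hj, hi => exact absurd (h2 hi).2 (h4 hj).2
  | 3, 4, hi, hj | 4, 3, hj, hi => exact absurd (h4 hj).1 (h3 hi).2.2

theorem HasForm.unique {i j : Fin 5} (hi : HasForm κ S i) (hj : HasForm κ S j) : i = j :=
  eq_of_separating_props (p := HasForm κ S) ContainsInitial.not_boundedAwayFrom
    ContainsInitial.ne_empty id HasForm.one HasForm.two HasForm.three HasForm.four hi hj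

/-! ### Listing the intervals from right to left -/

/-- `x > κ` and there is an interval to the left of `x` that does not meet `S`. -/
def LeftGap (κ : EReal) (S : Set ℝ) (x : ℝ) : Prop :=
  κ < x ∧ ∃ c < x, ∀ y, c < y → y < x → y ∉ S

/-- Here `b` is the supremum of `S` below `x`, and `a` is the supremum of the complement of `S` in
`(κ, b]`. Both lie in `S` by relative closedness; the values of `d` being natural numbers prevents
pieces of `S` from accumulating at `a` from below. -/
theorem exists_next_interval (hS : ∀ x ∈ S, κ < x)
    (hopen : ∀ x : ℝ, κ < x → x ∉ S → ∃ ε > 0, ∀ y, |y - x| < ε → y ∉ S) (d : ℝ → ℕ)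
    (hd : ∀ x y : ℝ, κ < x → x ∉ S → x < y → y ∉ S →
      d y ≤ d x ∧ (d y = d x → ∀ z ∈ Icc x y, z ∉ S))
    {x : ℝ} (hx : LeftGap κ S x) (hne : ∃ s ∈ S, s < x) :
    ∃ a b : ℝ, a ≤ b ∧ b < x ∧ κ < a ∧ Icc a b ⊆ S ∧ (∀ y ∈ S, y < x → y ≤ b) ∧
      ((∀ y : ℝ, κ < y → y ≤ b → y ∈ S) ∨ LeftGap κ S a) := by
  obtain ⟨s, hs, hsx⟩ := hne
  obtain ⟨-, c, hcx, hc⟩ := hx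
  set T : Set ℝ := {y | y ∈ S ∧ y < x} with hT
  have hTne : T.Nonempty := ⟨s, hs, hsx⟩
  have hTc : ∀ y ∈ T, y ≤ c := fun y hy => not_lt.mp fun h => hc y h hy.2 hy.1
  have hTb : BddAbove T := ⟨c, hTc⟩
  set b := sSup T with hb
  have hbx : b < x := (csSup_le hTne hTc).trans_lt hcx
  have hκb : κ < b := (hS s hs).trans_le (EReal.coe_le_coe_iff.mpr (le_csSup hTb ⟨hs, hsx⟩))
  have hleb : ∀ y ∈ S, y < x → y ≤ b := fun y h1 h2 => le_csSup hTb ⟨h1, h2⟩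
  have hbS : b ∈ S := by
    by_contra hbS
    obtain ⟨ε, hε, hball⟩ := hopen b hκb hbS
    obtain ⟨y, hy, hyb⟩ := exists_lt_of_lt_csSup hTne (show b - ε < sSup T by linarith)
    refine hball y ?_ hy.1
    rw [abs_lt]
    constructor <;> linarith [hleb y hy.1 hy.2]
  by_cases hfull : ∀ y : ℝ, κ < y → y ≤ b → y ∈ S
  · exact ⟨b, b, le_rfl, hbx, hκb, by simpa using hbS, hleb, Or.inl hfull⟩
  push Not at hfull
  obtain ⟨y₀, hκy₀, hy₀b, hy₀⟩ := hfull
  set R : Set ℝ := {y | κ < y ∧ y ≤ b ∧ y ∉ S} with hR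
  have hRne : R.Nonempty := ⟨y₀, hκy₀, hy₀b, hy₀⟩
  have hRb : BddAbove R := ⟨b, fun y hy => hy.2.1⟩
  set a := sSup R with ha
  have hab : a ≤ b := csSup_le hRne fun y hy => hy.2.1
  have hκa : κ < a :=
    hκy₀.trans_le (EReal.coe_le_coe_iff.mpr (le_csSup hRb ⟨hκy₀, hy₀b, hy₀⟩))
  have haS : a ∈ S := by
    by_contra haS
    have hlt : a < b := lt_of_le_of_ne hab fun h => haS (h ▸ hbS)
    obtain ⟨ε, hε, hball⟩ := hopen a hκa haS
    obtain ⟨z, hz1, hz2⟩ := exists_between (lt_min hlt (show a < a + ε by linarith))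
    have hzε := hz2.trans_le (min_le_right _ _)
    have hzR : z ∈ R := ⟨hκa.trans (EReal.coe_lt_coe_iff.mpr hz1),
      (hz2.trans_le (min_le_left _ _)).le, hball z (by rw [abs_lt]; constructor <;> linarith)⟩
    exact absurd (le_csSup hRb hzR) (not_le.mpr hz1)
  refine ⟨a, b, hab, hbx, hκa, fun y hy => ?_, hleb, Or.inr ⟨hκa, ?_⟩⟩
  · by_contra hyS
    have hya : y ≤ a :=
      le_csSup hRb ⟨hκa.trans_le (EReal.coe_le_coe_iff.mpr hy.1), hy.2, hyS⟩
    exact hyS (le_antisymm hya hy.1 ▸ haS)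
  · obtain ⟨y₁, hy₁, hmin⟩ := WellFounded.has_min (measure d).wf R hRne
    refine ⟨y₁, lt_of_le_of_ne (le_csSup hRb hy₁) fun h => hy₁.2.2 (h ▸ haS), fun z hz1 hz2 => ?_⟩
    obtain ⟨y₂, hy₂, hzy₂⟩ := exists_lt_of_lt_csSup hRne hz2
    have h1 := hd y₁ y₂ hy₁.1 hy₁.2.2 (hz1.trans hzy₂) hy₂.2.2
    exact h1.2 (le_antisymm h1.1 (not_lt.mp (hmin y₂ hy₂))) z ⟨hz1.le, hzy₂.le⟩

theorem exists_hasForm (hS : ∀ x ∈ S, κ < x) {C : ℝ} (hC : ∀ x ∈ S, x ≤ C)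
    (hopen : ∀ x : ℝ, κ < x → x ∉ S → ∃ ε > 0, ∀ y, |y - x| < ε → y ∉ S) (d : ℝ → ℕ)
    (hd : ∀ x y : ℝ, κ < x → x ∉ S → x < y → y ∉ S →
      d y ≤ d x ∧ (d y = d x → ∀ z ∈ Icc x y, z ∉ S)) :
    ∃ i, HasForm κ S i := by
  rcases S.eq_empty_or_nonempty with hempty | ⟨s₀, hs₀⟩
  · exact ⟨0, hempty⟩
  have hstep : ∀ x : ℝ, ∃ a b : ℝ, LeftGap κ S x → (∃ s ∈ S, s < x) →
      a ≤ b ∧ b < x ∧ κ < a ∧ Icc a b ⊆ S ∧ (∀ y ∈ S, y < x → y ≤ b) ∧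
      ((∀ y : ℝ, κ < y → y ≤ b → y ∈ S) ∨ LeftGap κ S a) := fun x => by
    by_cases h : LeftGap κ S x ∧ ∃ s ∈ S, s < x
    · obtain ⟨a, b, hab⟩ := exists_next_interval hS hopen d hd h.1 h.2
      exact ⟨a, b, fun _ _ => hab⟩
    · exact ⟨0, 0, fun h1 h2 => absurd ⟨h1, h2⟩ h⟩
  choose α β hαβ using hstep
  -- `a 0 = C + 1` only starts the recursion, to the right of `S`; the intervals are numbered from 1
  -- and `b 0` is never used.
  let a : ℕ → ℝ := fun n => α^[n] (C + 1)
  let b : ℕ → ℝ := fun n => β (a (n - 1))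
  have ha : ∀ n, a (n + 1) = α (a n) := fun n => Function.iterate_succ_apply' α n _
  have hb : ∀ n, b (n + 1) = β (a n) := fun n => rfl
  have hgap0 : LeftGap κ S (a 0) := by
    refine ⟨(hS s₀ hs₀).trans_le (EReal.coe_le_coe_iff.mpr ((hC s₀ hs₀).trans ?_)), C, ?_, ?_⟩
    · change C ≤ C + 1; linarith
    · change C < C + 1; linarith
    · exact fun y hy _ hyS => absurd (hC y hyS) (not_le.mpr hy)
  let full : ℕ → Prop := fun n => ∀ y : ℝ, κ < y → y ≤ b (n + 1) → y ∈ S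
  let cont : ℕ → Prop := fun n => (∃ s ∈ S, s < a n) ∧ ¬ full n
  have hstep : ∀ n, LeftGap κ S (a n) → (∃ s ∈ S, s < a n) →
      a (n + 1) ≤ b (n + 1) ∧ b (n + 1) < a n ∧ κ < a (n + 1) ∧ Icc (a (n + 1)) (b (n + 1)) ⊆ S ∧
      (∀ y ∈ S, y < a n → y ≤ b (n + 1)) ∧ (full n ∨ LeftGap κ S (a (n + 1))) := fun n h1 h2 => by
    rw [ha]; exact hαβ (a n) h1 h2
  have hgap : ∀ n, (∀ m < n, cont m) → LeftGap κ S (a n) := by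
    intro n
    induction n with
    | zero => exact fun _ => hgap0
    | succ n ih =>
      intro h
      have h1 := hstep n (ih fun m hm => h m (by omega)) (h n (by omega)).1
      exact h1.2.2.2.2.2.resolve_left (h n (by omega)).2
  have hcover : ∀ n, (∀ m < n, LeftGap κ S (a m) ∧ ∃ s ∈ S, s < a m) → ∀ s ∈ S, a n ≤ s →
      ∃ m ∈ Icc 1 n, s ∈ Icc (a m) (b m) := by
    intro n
    induction n with
    | zero =>
      intro _ s hs h
      have h1 : C + 1 ≤ s := h
      linarith [hC s hs]
    | succ n ih =>
      intro h s hs has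
      rcases le_or_gt (a n) s with hle | hlt
      · obtain ⟨m, hm, hsm⟩ := ih (fun m hm => h m (by omega)) s hs hle
        exact ⟨m, ⟨hm.1, by have := hm.2; omega⟩, hsm⟩
      · have h1 := hstep n (h n (by omega)).1 (h n (by omega)).2
        exact ⟨n + 1, ⟨by omega, le_rfl⟩, has, h1.2.2.2.2.1 s hs hlt⟩
  by_cases hall : ∀ n, cont n
  · have hG : ∀ n, LeftGap κ S (a n) := fun n => hgap n fun m _ => hall m
    have hst := fun n => hstep n (hG n) (hall n).1
    have hch : InfiniteChain a b := by
      intro n hn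
      obtain ⟨m, rfl⟩ := Nat.exists_eq_add_of_le' hn
      exact ⟨(hst m).1, (hst (m + 1)).2.1⟩
    have hanti : Antitone a := antitone_nat_of_succ_le fun n => (hst n).1.trans (hst n).2.1.le
    have hcov : ∀ s ∈ S, ∀ n, a n ≤ s → s ∈ ⋃ n ∈ Ici 1, Icc (a n) (b n) := fun s hs n hn => by
      obtain ⟨m, hm, hsm⟩ := hcover n (fun m _ => ⟨hG m, (hall m).1⟩) s hs hn
      exact mem_biUnion (show m ∈ Ici 1 from hm.1) hsm
    have hsub : (⋃ n ∈ Ici 1, Icc (a n) (b n)) ⊆ S := iUnion₂_subset fun n hn => by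
      obtain ⟨m, rfl⟩ := Nat.exists_eq_add_of_le' (show 1 ≤ n from hn)
      exact (hst m).2.2.2.1
    by_cases hlow : ∃ L : ℝ, κ < L ∧ ∀ n, L ≤ a n
    · obtain ⟨L, hκL, hL⟩ := hlow
      have hbdd : BddBelow (range a) := ⟨L, forall_mem_range.mpr hL⟩
      have hlim := tendsto_atTop_ciInf hanti hbdd
      refine ⟨4, a, b, ⨅ n, a n, hch, hlim,
        hκL.trans_le (EReal.coe_le_coe_iff.mpr (le_ciInf hL)), Subset.antisymm ?_ ?_⟩
      · intro s hs
        rcases le_or_gt s (⨅ n, a n) with hle | hlt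
        · exact Or.inr ⟨hS s hs, hle⟩
        · obtain ⟨n, hn⟩ := exists_lt_of_ciInf_lt hlt
          exact Or.inl (hcov s hs n hn.le)
      · refine union_subset hsub ?_
        rintro x ⟨hκx, hx⟩
        by_contra hxS
        have hbetween : ∀ n, ∃ y, b (n + 1) < y ∧ y < a n := fun n => exists_between (hst n).2.1
        choose y hy1 hy2 using hbetween
        have hyS : ∀ n, y n ∉ S := fun n h =>
          absurd ((hst n).2.2.2.2.1 _ h (hy2 n)) (not_le.mpr (hy1 n))
        have hay : ∀ n, a (n + 1) < y n := fun n => (hst n).1.trans_lt (hy1 n)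
        have hxy : ∀ n, x < y n := fun n => (hx.trans (ciInf_le hbdd (n + 1))).trans_lt (hay n)
        -- Between the gap points `y (n + 1) < y n` lies `a (n + 1) ∈ S`, so `d` must jump. Yet `d
        -- x` would bound all the `d (y n)`.
        have hmono : StrictMono fun n => d (y n) := strictMono_nat_of_lt_succ fun n => by
          have h1 := hd (y (n + 1)) (y n) (hκx.trans (EReal.coe_lt_coe_iff.mpr (hxy _))) (hyS _)
            ((hy2 (n + 1)).trans (hay n)) (hyS _)
          refine lt_of_le_of_ne h1.1 fun h => ?_
          exact h1.2 h (a (n + 1)) ⟨(hy2 (n + 1)).le, (hay n).le⟩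
            ((hst n).2.2.2.1 ⟨le_rfl, (hst n).1⟩)
        have h1 := hmono.le_apply (x := d x + 1)
        have h2 := (hd x (y (d x + 1)) hκx hxS (hxy _) (hyS _)).1
        omega
    · push Not at hlow
      refine ⟨3, a, b, hch, tendsto_order.mpr ⟨fun l hl => ?_, fun u hu => ?_⟩,
        Subset.antisymm (fun s hs => ?_) hsub⟩
      · exact Eventually.of_forall fun n => hl.trans (hG n).1
      · obtain ⟨r, hr1, hr2⟩ := EReal.lt_iff_exists_real_btwn.mp hu
        obtain ⟨n, hn⟩ := hlow r hr1
        exact eventually_atTop.mpr ⟨n, fun m hm =>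
          (EReal.coe_lt_coe_iff.mpr ((hanti hm).trans_lt hn)).trans hr2⟩
      · obtain ⟨n, hn⟩ := hlow s (hS s hs)
        exact hcov s hs n hn.le
  · push Not at hall
    classical
    let n := Nat.find hall
    have hn : ¬ cont n := Nat.find_spec hall
    have hlt : ∀ m < n, cont m := fun m hm => not_not.mp (Nat.find_min hall hm)
    have hG : ∀ m ≤ n, LeftGap κ S (a m) := fun m hm => hgap m fun i hi => hlt i (by omega)
    have hst := fun m (hm : m < n) => hstep m (hG m hm.le) (hlt m hm).1
    by_cases hne : ∃ s ∈ S, s < a n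
    · have hfull : full n := by
        by_contra h
        exact hn ⟨hne, h⟩
      have hst' : ∀ m ≤ n, _ := fun m (hm : m ≤ n) => hstep m (hG m hm)
        (hm.eq_or_lt.elim (fun h => h ▸ hne) fun h => (hlt m h).1)
      -- The last interval is replaced by `(κ, b (n + 1)]`; `a (n + 1)` serves only the chain
      -- inequalities.
      refine ⟨2, n + 1, a, b, ⟨by omega, fun m hm => ?_, fun m hm => ?_,
        (hst' n le_rfl).2.2.1⟩, Subset.antisymm (fun s hs => ?_) (union_subset ?_ ?_)⟩
      · obtain ⟨m, rfl⟩ := Nat.exists_eq_add_of_le' hm.1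
        exact (hst' m (by have := hm.2; omega)).1
      · exact (hst' m (by have := hm.2; omega)).2.1
      · rcases le_or_gt (a n) s with hle | hgt
        · obtain ⟨m, hm, hsm⟩ := hcover n (fun m hm => ⟨hG m hm.le, (hlt m hm).1⟩) s hs hle
          exact Or.inl (mem_biUnion (show m ∈ Ico 1 (n + 1) from ⟨hm.1, by have := hm.2; omega⟩) hsm)
        · exact Or.inr ⟨hS s hs, (hst' n le_rfl).2.2.2.2.1 s hs hgt⟩
      · refine iUnion₂_subset fun m hm => ?_
        obtain ⟨m, rfl⟩ := Nat.exists_eq_add_of_le' hm.1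
        exact (hst' m (by have := hm.2; omega)).2.2.2.1
      · rintro x ⟨h1, h2⟩
        exact hfull x h1 h2
    · push Not at hne
      have hn1 : 1 ≤ n := by
        by_contra h
        have h0 : n = 0 := by omega
        have h1 : C + 1 ≤ s₀ := by have := hne s₀ hs₀; rwa [h0] at this
        linarith [hC s₀ hs₀]
      refine ⟨1, n, a, b, ⟨hn1, fun m hm => ?_, fun m hm => ?_, (hG n le_rfl).1⟩,
        Subset.antisymm (fun s hs => ?_) ?_⟩
      · obtain ⟨m, rfl⟩ := Nat.exists_eq_add_of_le' hm.1
        exact (hst m (by have := hm.2; omega)).1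
      · exact (hst m hm.2).2.1
      · obtain ⟨m, hm, hsm⟩ := hcover n (fun m hm => ⟨hG m hm.le, (hlt m hm).1⟩) s hs (hne s hs)
        exact mem_biUnion hm hsm
      · refine iUnion₂_subset fun m hm => ?_
        obtain ⟨m, rfl⟩ := Nat.exists_eq_add_of_le' hm.1
        exact (hst m (by have := hm.2; omega)).2.2.2.1

end Forms

/-! ### Dichotomies, their unstable spaces and the dimension count -/

section Dichotomies

variable {M 𝕜 X : Type*} [TopologicalSpace M] [RCLike 𝕜] [NormedAddCommGroup X] [NormedSpace 𝕜 X]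

/-- An exponential dichotomy with rates `α` and `β` for the cocycle `𝒜`, written without inverse
maps. -/
structure Dichotomy (f : M ≃ₜ M) (𝒜 : M → ℕ → X →L[𝕜] X) (P : M → X →L[𝕜] X) (α β D : ℝ) :
    Prop where
  idem : ∀ q, (P q).comp (P q) = P q
  comm : ∀ q, (𝒜 q 1).comp (P q) = (P (f q)).comp (𝒜 q 1)
  bijOn : ∀ q, BijOn (𝒜 q 1) {x | P q x = 0} {x | P (f q) x = 0}
  cont : Continuous P
  pos : 0 < D
  upper : ∀ q (n : ℕ) x, ‖𝒜 q n (P q x)‖ ≤ D * Real.exp (α * n) * ‖x‖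
  lower : ∀ q (n : ℕ) v, P q v = 0 → ‖v‖ ≤ D * Real.exp (-β * n) * ‖𝒜 q n v‖

variable {f : M ≃ₜ M} {𝒜 : M → ℕ → X →L[𝕜] X} {P P' : M → X →L[𝕜] X} {α α' β β' D D' : ℝ}

theorem iterate_apply_symm_iterate (f : M ≃ₜ M) (n : ℕ) (q : M) : f^[n] (f.symm^[n] q) = q :=
  Function.LeftInverse.iterate f.apply_symm_apply n q

theorem symm_iterate_apply_iterate (f : M ≃ₜ M) (n : ℕ) (q : M) : f.symm^[n] (f^[n] q) = q :=
  Function.LeftInverse.iterate f.symm_apply_apply n q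

theorem IsCocycle.bijOn (h𝒜 : IsCocycle f 𝒜) {K : M → Set X}
    (hK : ∀ q, BijOn (𝒜 q 1) (K q) (K (f q))) (n : ℕ) (q : M) :
    BijOn (𝒜 q n) (K q) (K (f^[n] q)) := by
  induction n with
  | zero => rw [h𝒜.map_zero]; exact bijOn_id _
  | succ n ih =>
    rw [h𝒜.map_add, Function.iterate_succ_apply']
    exact (hK _).comp ih

theorem IsCocycle.apply_comm (h𝒜 : IsCocycle f 𝒜)
    (hP : ∀ q, (𝒜 q 1).comp (P q) = (P (f q)).comp (𝒜 q 1)) (n : ℕ) (q : M) (x : X) :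
    𝒜 q n (P q x) = P (f^[n] q) (𝒜 q n x) := by
  induction n with
  | zero => simp [h𝒜.map_zero]
  | succ n ih =>
    rw [h𝒜.map_add, Function.iterate_succ_apply', ContinuousLinearMap.comp_apply,
      ContinuousLinearMap.comp_apply, ih]
    exact DFunLike.congr_fun (hP _) _

theorem IsCocycle.rescale (h𝒜 : IsCocycle f 𝒜) (a : ℝ) : IsCocycle f (rescale 𝒜 a) where
  map_zero q := by simp [SackerSell.rescale, h𝒜.map_zero]
  map_add q n m := by
    ext x
    simp only [SackerSell.rescale, h𝒜.map_add, smul_apply,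
      ContinuousLinearMap.comp_apply, map_smul, smul_smul, ← RCLike.ofReal_mul, ← Real.exp_add]
    congr 3
    push_cast; ring_nf
  continuous_generator := h𝒜.continuous_generator.const_smul ((Real.exp (-a * (1 : ℕ)) : ℝ) : 𝕜)

omit [TopologicalSpace M] in
theorem norm_rescale_apply (𝒜 : M → ℕ → X →L[𝕜] X) (a : ℝ) (q : M) (n : ℕ) (x : X) :
    ‖rescale 𝒜 a q n x‖ = Real.exp (-a * n) * ‖𝒜 q n x‖ := by
  simp [rescale, norm_smul, abs_of_pos (Real.exp_pos _)]

omit [TopologicalSpace M] in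
theorem rescale_rescale (𝒜 : M → ℕ → X →L[𝕜] X) (a b : ℝ) :
    rescale (rescale 𝒜 a) b = rescale 𝒜 (a + b) := by
  funext q n
  simp only [rescale, smul_smul, ← RCLike.ofReal_mul, ← Real.exp_add]
  congr 3
  ring

omit [TopologicalSpace M] in
theorem rescale_zero (𝒜 : M → ℕ → X →L[𝕜] X) : rescale 𝒜 0 = 𝒜 := by
  funext q n
  simp [rescale]

theorem Dichotomy.rescale (h : Dichotomy f 𝒜 P α β D) (c : ℝ) :
    Dichotomy f (rescale 𝒜 c) P (α - c) (β - c) D where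
  idem := h.idem
  comm q := by
    simp only [SackerSell.rescale, ContinuousLinearMap.smul_comp, ContinuousLinearMap.comp_smul,
      h.comm]
  bijOn q := by
    have hr : ((Real.exp (-c * (1 : ℕ)) : ℝ) : 𝕜) ≠ 0 :=
      RCLike.ofReal_ne_zero.mpr (Real.exp_pos _).ne'
    refine ⟨fun x hx => ?_, fun x hx y hy hxy => ?_, fun y hy => ?_⟩
    · have h1 : P (f q) (𝒜 q 1 x) = 0 := (h.bijOn q).mapsTo hx
      change P (f q) (((Real.exp (-c * (1 : ℕ)) : ℝ) : 𝕜) • 𝒜 q 1 x) = 0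
      rw [map_smul, h1, smul_zero]
    · exact (h.bijOn q).injOn hx hy (smul_right_injective X hr hxy)
    · obtain ⟨x, hx, hxy⟩ := (h.bijOn q).surjOn
        (show ((Real.exp (-c * (1 : ℕ)) : ℝ) : 𝕜)⁻¹ • y ∈ {x | P (f q) x = 0} by
          change P (f q) (((Real.exp (-c * (1 : ℕ)) : ℝ) : 𝕜)⁻¹ • y) = 0
          rw [map_smul, show P (f q) y = 0 from hy, smul_zero])
      refine ⟨x, hx, ?_⟩
      change ((Real.exp (-c * (1 : ℕ)) : ℝ) : 𝕜) • 𝒜 q 1 x = y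
      rw [hxy, smul_inv_smul₀ hr]
  cont := h.cont
  pos := h.pos
  upper q n x := by
    rw [norm_rescale_apply, show (α - c) * n = -c * n + α * n by ring, Real.exp_add]
    have := mul_le_mul_of_nonneg_left (h.upper q n x) (Real.exp_pos (-c * n)).le
    linarith
  lower q n v hv := by
    rw [norm_rescale_apply, show -(β - c) * n = -β * n + c * n by ring, Real.exp_add]
    have h1 : Real.exp (c * n) * Real.exp (-c * n) = 1 := by rw [← Real.exp_add]; simp
    calc ‖v‖ ≤ D * Real.exp (-β * n) * ‖𝒜 q n v‖ := h.lower q n v hv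
      _ = D * Real.exp (-β * n) * (Real.exp (c * n) * Real.exp (-c * n)) * ‖𝒜 q n v‖ := by
        rw [h1, mul_one]
      _ = _ := by ring

theorem Dichotomy.mono (h : Dichotomy f 𝒜 P α β D) (hα : α ≤ α') (hβ : β' ≤ β) :
    Dichotomy f 𝒜 P α' β' D where
  __ := h
  upper q n x := (h.upper q n x).trans (by
    have := h.pos
    gcongr)
  lower q n v hv := (h.lower q n v hv).trans (by
    have := h.pos
    gcongr)

theorem Dichotomy.uniformlyHyperbolic (h𝒜 : IsCocycle f 𝒜) {l : ℝ} (hl : 0 < l)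
    (h : Dichotomy f 𝒜 P (-l) l D) : UniformlyHyperbolic f 𝒜 := by
  have hD := h.pos
  -- At `n = 0` the upper bound gives `‖P q‖ ≤ D`, so `1 + D` bounds `Id - P q`.
  refine ⟨P, h.idem, h.comm, h.bijOn, h.cont, D * (1 + D), l, by positivity, hl,
    fun q n => ⟨?_, fun x => ?_⟩⟩
  · refine ContinuousLinearMap.opNorm_le_bound _ (by positivity) fun x => ?_
    refine (h.upper q n x).trans ?_
    gcongr
    nlinarith
  · have hPx : ‖P q x‖ ≤ D * ‖x‖ := by simpa [h𝒜.map_zero] using h.upper q 0 x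
    have hker : P q (x - P q x) = 0 := by
      rw [map_sub, ← ContinuousLinearMap.comp_apply, h.idem, sub_self]
    have hb := h𝒜.bijOn h.bijOn n (f.symm^[n] q)
    rw [iterate_apply_symm_iterate] at hb
    have hex := hb.surjOn (show x - P q x ∈ {x | P q x = 0} from hker)
    have h1 := h.lower (f.symm^[n] q) n _ (Function.invFunOn_mem hex)
    rw [Function.invFunOn_eq hex] at h1
    calc ‖backward f 𝒜 P q n (x - P q x)‖ ≤ D * Real.exp (-l * n) * ‖x - P q x‖ := h1
      _ ≤ D * Real.exp (-l * n) * (‖x‖ + D * ‖x‖) := by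
        gcongr
        exact (norm_sub_le _ _).trans (by gcongr)
      _ = _ := by ring

theorem UniformlyHyperbolic.exists_dichotomy (h𝒜 : IsCocycle f 𝒜) (h : UniformlyHyperbolic f 𝒜) :
    ∃ P D l, 0 < l ∧ Dichotomy f 𝒜 P (-l) l D := by
  obtain ⟨P, hidem, hcomm, hbij, hcont, D, l, hD, hl, hb⟩ := h
  refine ⟨P, D, l, hl, hidem, hcomm, hbij, hcont, hD, fun q n x => ?_, fun q n v hv => ?_⟩
  · exact ((𝒜 q n).comp (P q)).le_of_opNorm_le (hb q n).1 x
  · have hbn := h𝒜.bijOn hbij n q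
    have h1 := (hb (f^[n] q) n).2 (𝒜 q n v)
    rw [show P (f^[n] q) (𝒜 q n v) = 0 from hbn.mapsTo hv, sub_zero, backward,
      symm_iterate_apply_iterate, hbn.injOn.leftInvOn_invFunOn hv] at h1
    exact h1

theorem uniformlyHyperbolic_rescale_of_dichotomy (h𝒜 : IsCocycle f 𝒜)
    (h : Dichotomy f 𝒜 P α β D) {a : ℝ} (hα : α < a) (hβ : a < β) :
    UniformlyHyperbolic f (rescale 𝒜 a) :=
  ((h.rescale a).mono (α' := -min (a - α) (β - a)) (β' := min (a - α) (β - a))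
    (by have := min_le_left (a - α) (β - a); linarith) (min_le_right _ _)).uniformlyHyperbolic
    (h𝒜.rescale a) (lt_min (by linarith) (by linarith))

theorem UniformlyHyperbolic.exists_dichotomy_of_rescale (h𝒜 : IsCocycle f 𝒜) {a : ℝ}
    (h : UniformlyHyperbolic f (rescale 𝒜 a)) :
    ∃ P D l, 0 < l ∧ Dichotomy f 𝒜 P (a - l) (a + l) D := by
  obtain ⟨P, D, l, hl, hd⟩ := h.exists_dichotomy (h𝒜.rescale a)
  have h1 := hd.rescale (-a)
  rw [rescale_rescale, add_neg_cancel, rescale_zero] at h1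
  exact ⟨P, D, l, hl, h1.mono (by linarith) (by linarith)⟩

/-- Pull `v ∈ Ker P'(q)` back `n` steps to `u`, which has size at most `D' e^{-β' n} ‖v‖`. Pushing
`P u` forward gives `P(q) v` and costs at most `D e^{α n}`, so `P(q) v` is bounded by a multiple of
`e^{(α - β') n}`. -/
theorem Dichotomy.ker_le (h𝒜 : IsCocycle f 𝒜) (h : Dichotomy f 𝒜 P α β D)
    (h' : Dichotomy f 𝒜 P' α' β' D') (hαβ : α < β') (q : M) :
    LinearMap.ker (P' q).toLinearMap ≤ LinearMap.ker (P q).toLinearMap := by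
  intro v hv
  have hD := h.pos
  have key : ∀ n : ℕ, ‖P q v‖ ≤ D * D' * ‖v‖ * Real.exp ((α - β') * n) := fun n => by
    have hb := h𝒜.bijOn h'.bijOn n (f.symm^[n] q)
    rw [iterate_apply_symm_iterate] at hb
    obtain ⟨u, hu, rfl⟩ := hb.surjOn (show v ∈ {x | P' q x = 0} from hv)
    have h1 := h𝒜.apply_comm h.comm n (f.symm^[n] q) u
    rw [iterate_apply_symm_iterate] at h1
    rw [← h1]
    refine (h.upper _ n u).trans ?_
    calc D * Real.exp (α * n) * ‖u‖
        ≤ D * Real.exp (α * n) * (D' * Real.exp (-β' * n) * ‖𝒜 (f.symm^[n] q) n u‖) := by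
          gcongr; exact h'.lower _ n u hu
      _ = _ := by
        rw [show (α - β') * n = α * n + -β' * n by ring, Real.exp_add]; ring
  have hlim : Tendsto (fun n : ℕ => D * D' * ‖v‖ * Real.exp ((α - β') * n)) atTop (𝓝 0) := by
    rw [← mul_zero (D * D' * ‖v‖)]
    refine (Real.tendsto_exp_atBot.comp ?_).const_mul _
    exact tendsto_natCast_atTop_atTop.const_mul_atTop_of_neg (by linarith)
  exact norm_le_zero_iff.mp (ge_of_tendsto' hlim key)

/-- The stable estimate involves only `P`, and the unstable one only vectors of `Ker P`, where that
of `P'` is available. -/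
theorem Dichotomy.join (h : Dichotomy f 𝒜 P α β D) (h' : Dichotomy f 𝒜 P' α' β' D')
    (hker : ∀ q, LinearMap.ker (P q).toLinearMap ≤ LinearMap.ker (P' q).toLinearMap) :
    Dichotomy f 𝒜 P α β' (max D D') where
  __ := h
  pos := lt_max_of_lt_left h.pos
  upper q n x := (h.upper q n x).trans (by gcongr; exact le_max_left _ _)
  lower q n v hv := (h'.lower q n v (hker q hv)).trans (by gcongr; exact le_max_right _ _)

/-- `Id - Q` maps `Ker P` injectively into `Ker Q`: if `P x = 0` and `Q x = x`, then `Q - P` fixes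
`x`. -/
theorem rank_ker_le_of_norm_sub_lt_one {P Q : X →L[𝕜] X} (hQ : Q.comp Q = Q) (h : ‖Q - P‖ < 1) :
    Module.rank 𝕜 (LinearMap.ker P.toLinearMap) ≤ Module.rank 𝕜 (LinearMap.ker Q.toLinearMap) := by
  have hQ' : ∀ x, Q (Q x) = Q x := fun x => DFunLike.congr_fun hQ x
  let T : LinearMap.ker P.toLinearMap →ₗ[𝕜] LinearMap.ker Q.toLinearMap :=
    (LinearMap.id - Q.toLinearMap).restrict fun x _ => by simp [hQ']
  refine LinearMap.rank_le_of_injective T ((injective_iff_map_eq_zero T).mpr fun x hx => ?_)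
  have h1 : (x : X) - Q x = 0 := congrArg Subtype.val hx
  have h2 : P x = 0 := x.2
  have h3 : (Q - P) (x : X) = x := by
    simpa [h2] using (sub_eq_zero.mp h1).symm
  have h4 := (Q - P).le_opNorm x
  rw [h3] at h4
  have h5 : ‖(x : X)‖ = 0 := by
    by_contra hne
    have : 0 < ‖(x : X)‖ := lt_of_le_of_ne (norm_nonneg _) (Ne.symm hne)
    nlinarith
  exact Subtype.ext (norm_eq_zero.mp h5)

theorem Dichotomy.rank_ker_eq (hM : InvariantlyConnected f) (h : Dichotomy f 𝒜 P α β D)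
    (q q' : M) : Module.rank 𝕜 (LinearMap.ker (P q).toLinearMap) =
      Module.rank 𝕜 (LinearMap.ker (P q').toLinearMap) := by
  have hloc : IsLocallyConstant fun q => Module.rank 𝕜 (LinearMap.ker (P q).toLinearMap) := by
    refine (IsLocallyConstant.iff_eventually_eq _).mpr fun q => ?_
    have hnear : ∀ᶠ y in 𝓝 q, ‖P y - P q‖ < 1 := by
      have := Metric.tendsto_nhds.mp (h.cont.tendsto q) 1 one_pos
      simpa only [dist_eq_norm] using this
    filter_upwards [hnear] with y hy
    exact le_antisymm (rank_ker_le_of_norm_sub_lt_one (h.idem q) (by rwa [norm_sub_rev]))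
      (rank_ker_le_of_norm_sub_lt_one (h.idem y) hy)
  have hinv : ∀ q, Module.rank 𝕜 (LinearMap.ker (P (f q)).toLinearMap) =
      Module.rank 𝕜 (LinearMap.ker (P q).toLinearMap) := fun q => by
    let T : LinearMap.ker (P q).toLinearMap →ₗ[𝕜] LinearMap.ker (P (f q)).toLinearMap :=
      (𝒜 q 1).toLinearMap.restrict fun x hx => (h.bijOn q).mapsTo hx
    refine (LinearEquiv.rank_eq (LinearEquiv.ofBijective T ⟨fun x y hxy => ?_, fun y => ?_⟩)).symm
    · exact Subtype.ext ((h.bijOn q).injOn x.2 y.2 (congrArg Subtype.val hxy))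
    · obtain ⟨x, hx, hxy⟩ := (h.bijOn q).surjOn y.2
      exact ⟨⟨x, hx⟩, Subtype.ext hxy⟩
  rcases hM {y | Module.rank 𝕜 (LinearMap.ker (P y).toLinearMap) =
      Module.rank 𝕜 (LinearMap.ker (P q).toLinearMap)}
    (hloc.isClopen_fiber (Module.rank 𝕜 (LinearMap.ker (P q).toLinearMap)))
    (by ext y; simp [hinv]) with h0 | h1
  · exact absurd (show q ∈ (∅ : Set M) from h0 ▸ rfl) (notMem_empty q)
  · exact (show q' ∈ {y | Module.rank 𝕜 (LinearMap.ker (P y).toLinearMap) =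
      Module.rank 𝕜 (LinearMap.ker (P q).toLinearMap)} from h1 ▸ mem_univ q').symm

/-- A map that expands an infinite-dimensional subspace by the factor `c` has `icNorm` at least
`c / 6`. -/
theorem le_icNorm_of_infinite {A : X →L[𝕜] X} {V : Submodule 𝕜 X} (hV : ¬ FiniteDimensional 𝕜 V)
    {c : ℝ} (hc : ∀ v ∈ V, c * ‖v‖ ≤ ‖A v‖) (hc0 : 0 ≤ c) : c / 6 ≤ icNorm A := by
  -- Riesz's lemma gives vectors of norm at most 3 at mutual distance at least 1. Scaled by `1/3`
  -- they lie in the unit ball and have images `c/3` apart, so two images in one ball of radius `r`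
  -- force `c/3 < 2r`.
  obtain ⟨v, hv, hsep⟩ := exists_seq_norm_le_one_le_norm_sub' (𝕜 := 𝕜) (c := 2) (R := 3)
    (by simp) (by simp; norm_num) hV
  refine le_csInf ⟨‖A‖ + 1, by positivity, {0}, ?_⟩ ?_
  · rintro _ ⟨x, hx, rfl⟩
    have h1 : ‖x‖ ≤ 1 := by simpa using hx
    have h2 := A.le_opNorm x
    simp only [Finset.mem_singleton, iUnion_iUnion_eq_left, mem_ball_zero_iff]
    nlinarith [norm_nonneg A]
  · rintro r ⟨hr, t, ht⟩
    let w : ℕ → X := fun i => ((3 : ℝ)⁻¹ : 𝕜) • (v i : X)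
    have h3 : ‖(((3 : ℝ)⁻¹ : ℝ) : 𝕜)‖ = 3⁻¹ := by simp
    have hw : ∀ i, ∃ x ∈ t, A (w i) ∈ Metric.ball x r := fun i => by
      have h1 : A (w i) ∈ A '' Metric.closedBall 0 1 := by
        refine mem_image_of_mem _ ?_
        rw [mem_closedBall_zero_iff, norm_smul]
        have := hv i
        simp only [Submodule.coe_norm] at this
        simp; linarith
      simpa only [mem_iUnion, exists_prop] using ht h1
    choose x hxt hx using hw
    obtain ⟨i, j, hij, hxij⟩ := Finite.exists_ne_map_eq_of_infinite (fun i => (⟨x i, hxt i⟩ : t))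
    have hxij : x i = x j := congrArg Subtype.val hxij
    have h1 : dist (A (w i)) (A (w j)) < 2 * r := by
      have hi := Metric.mem_ball.mp (hx i)
      have hj := Metric.mem_ball'.mp (hx j)
      rw [← hxij] at hj
      linarith [dist_triangle (A (w i)) (x i) (A (w j))]
    have h2 : A (w i) - A (w j) = ((3 : ℝ)⁻¹ : 𝕜) • A ((v i - v j : V) : X) := by
      simp [w, smul_sub]
    rw [dist_eq_norm, h2, norm_smul] at h1
    have h4 := hc _ (v i - v j).2
    have h5 : c * 1 ≤ c * ‖((v i - v j : V) : X)‖ := mul_le_mul_of_nonneg_left (hsep hij) hc0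
    have h6 : ‖(((3 : ℝ) : 𝕜)⁻¹ : 𝕜)‖ = 3⁻¹ := by simp
    rw [h6] at h1
    linarith

theorem le_growthRate {M : Type*} [MeasurableSpace M] {μ : Measure M} (hμ : μ ≠ 0)
    {F : ℕ → M → ℝ} {c β : ℝ} (hc : 0 < c) (hF : ∀ (n : ℕ) q, c * Real.exp (β * n) ≤ F n q) :
    (β : EReal) ≤ growthRate μ F := by
  unfold growthRate
  rw [← essSup_const (β : EReal) hμ]
  refine essSup_mono_ae (Eventually.of_forall fun q => ?_)
  have hlim : Tendsto (fun n : ℕ => (((Real.log c + β * n) / n : ℝ) : EReal)) atTop (𝓝 β) := by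
    refine (continuous_coe_real_ereal.tendsto β).comp ?_
    have h1 : Tendsto (fun n : ℕ => Real.log c / n + β) atTop (𝓝 (0 + β)) :=
      (tendsto_const_div_atTop_nhds_zero_nat _).add_const β
    rw [zero_add] at h1
    refine h1.congr' ?_
    filter_upwards [eventually_gt_atTop 0] with n hn
    have : (n : ℝ) ≠ 0 := by positivity
    field_simp
  change (β : EReal) ≤ _
  rw [← hlim.limsup_eq]
  refine limsup_le_limsup (Eventually.of_forall fun n => ?_)
  change (((Real.log c + β * n) / n : ℝ) : EReal) ≤ _
  rw [EReal.coe_div]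
  refine EReal.div_le_div_right_of_nonneg (by exact_mod_cast Nat.zero_le n) ?_
  have hpos : 0 < c * Real.exp (β * n) := by positivity
  have h1 : (Real.log c + β * n : ℝ) = Real.log (c * Real.exp (β * n)) := by
    rw [Real.log_mul hc.ne' (Real.exp_pos _).ne', Real.log_exp]
  rw [h1, ← ENNReal.log_ofReal_of_pos hpos]
  exact ENNReal.log_le_log (ENNReal.ofReal_le_ofReal (hF n q))

/-- One infinite-dimensional kernel makes all of them infinite-dimensional, so the `icNorm` grows at
least like `e^{β n}` at every point, hence for any ergodic measure. -/
theorem Dichotomy.finiteDimensional_ker [CompactSpace M] [T2Space M] [MeasurableSpace M]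
    [BorelSpace M] (hM : InvariantlyConnected f) (h : Dichotomy f 𝒜 P α β D)
    (hκ : kappa f 𝒜 < β) (q : M) : FiniteDimensional 𝕜 (LinearMap.ker (P q).toLinearMap) := by
  by_contra hq
  have hinf : ∀ y, ¬ FiniteDimensional 𝕜 (LinearMap.ker (P y).toLinearMap) := fun y hy => by
    exact hq (Module.rank_lt_aleph0_iff.mp
      (h.rank_ker_eq hM q y ▸ Module.rank_lt_aleph0_iff.mpr hy))
  have : Nonempty M := ⟨q⟩
  obtain ⟨μ, hμ⟩ := ergodicMeasures_nonempty f
  have := hμ.1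
  have hD := h.pos
  have h1 : (β : EReal) ≤ icExponent 𝒜 μ := by
    refine le_growthRate (c := D⁻¹ / 6) (IsProbabilityMeasure.ne_zero μ) (by positivity)
      fun n y => ?_
    have h2 := le_icNorm_of_infinite (A := 𝒜 y n) (hinf y) (c := D⁻¹ * Real.exp (β * n))
      (fun v hv => ?_) (by positivity)
    · linarith
    · rw [mul_assoc, inv_mul_le_iff₀ hD]
      have h3 := mul_le_mul_of_nonneg_left (h.lower y n v hv) (Real.exp_pos (β * n)).le
      refine h3.trans (le_of_eq ?_)
      have h4 : Real.exp (β * n) * Real.exp (-β * n) = 1 := by rw [← Real.exp_add]; simp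
      linear_combination (D * ‖𝒜 y n v‖) * h4
  exact absurd hκ (not_lt.mpr (h1.trans (le_iSup₂ (f := fun μ _ => icExponent 𝒜 μ) μ hμ)))

theorem IsCocycle.exists_forall_uniformlyHyperbolic [CompactSpace M] (h𝒜 : IsCocycle f 𝒜) :
    ∃ C : ℝ, ∀ a, C < a → UniformlyHyperbolic f (SackerSell.rescale 𝒜 a) := by
  obtain ⟨K, hK⟩ := isCompact_univ.exists_bound_of_continuousOn
    h𝒜.continuous_generator.continuousOn
  have hK1 : 0 < max K 1 := lt_max_of_lt_right one_pos
  have hn : ∀ q n, ‖𝒜 q n‖ ≤ Real.exp (Real.log (max K 1) * n) := fun q n => by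
    rw [mul_comm, Real.exp_nat_mul, Real.exp_log hK1]
    induction n with
    | zero => rw [h𝒜.map_zero, pow_zero]; exact ContinuousLinearMap.norm_id_le
    | succ n ih =>
      rw [h𝒜.map_add, pow_succ']
      refine (ContinuousLinearMap.opNorm_comp_le _ _).trans ?_
      exact mul_le_mul ((hK _ (mem_univ _)).trans (le_max_left _ _)) ih (norm_nonneg _) hK1.le
  refine ⟨Real.log (max K 1), fun a ha => ?_⟩
  -- With `P = Id` the unstable spaces vanish and any `β > a` will do.
  refine uniformlyHyperbolic_rescale_of_dichotomy (P := fun _ => ContinuousLinearMap.id 𝕜 X)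
    (β := a + 1) (D := 1) h𝒜 ⟨fun q => rfl, fun q => rfl, fun q => ?_, continuous_const, one_pos,
      fun q n x => ?_, fun q n v hv => ?_⟩ ha (by linarith)
  · simp [BijOn, MapsTo, InjOn, SurjOn]
  · rw [one_mul]
    exact (𝒜 q n).le_of_opNorm_le (hn q n) x
  · have hv0 : v = 0 := hv
    simp [hv0]

end Dichotomies

end SackerSell

end

/-! ### The spectral theorem -/

theorem theorem3p8 {M 𝕜 X : Type*} [TopologicalSpace M] [CompactSpace M] [T2Space M]
    [MeasurableSpace M] [BorelSpace M] [RCLike 𝕜] [NormedAddCommGroup X] [NormedSpace 𝕜 X]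
    [CompleteSpace X] (f : M ≃ₜ M) (hM : SackerSell.InvariantlyConnected f)
    (𝒜 : M → ℕ → X →L[𝕜] X) (h𝒜 : SackerSell.IsCocycle f 𝒜)
    (hq : ∀ μ ∈ SackerSell.ergodicMeasures f, SackerSell.Quasicompact 𝒜 μ) :
    ∃! i : Fin 5, SackerSell.HasForm (SackerSell.kappa f 𝒜) (SackerSell.spectrum f 𝒜) i := by
  open SackerSell in
  refine existsUnique_of_exists_of_unique ?_ fun i j => HasForm.unique
  -- The hypotheses on `a` sit inside the existential so that `choose` yields projections indexed by
  -- all reals, with zero as the default.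
  have hdich : ∀ a : ℝ, ∃ (P : M → X →L[𝕜] X) (D l : ℝ), kappa f 𝒜 < a → a ∉ spectrum f 𝒜 →
      0 < l ∧ Dichotomy f 𝒜 P (a - l) (a + l) D := fun a => by
    by_cases ha : kappa f 𝒜 < a ∧ a ∉ spectrum f 𝒜
    · obtain ⟨P, D, l, hl, h⟩ := UniformlyHyperbolic.exists_dichotomy_of_rescale h𝒜
        (not_not.mp fun h => ha.2 ⟨ha.1, h⟩)
      exact ⟨P, D, l, fun _ _ => ⟨hl, h⟩⟩
    · exact ⟨0, 0, 0, fun h1 h2 => absurd ⟨h1, h2⟩ ha⟩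
  choose P D l hP using hdich
  obtain ⟨C, hC⟩ := h𝒜.exists_forall_uniformlyHyperbolic
  have hle : ∀ x ∈ spectrum f 𝒜, x ≤ C := fun x hx => not_lt.mp fun h => hx.2 (hC x h)
  have hopen : ∀ x : ℝ, kappa f 𝒜 < x → x ∉ spectrum f 𝒜 →
      ∃ ε > 0, ∀ y, |y - x| < ε → y ∉ spectrum f 𝒜 := fun x h1 h2 => by
    obtain ⟨hl, hd⟩ := hP x h1 h2
    refine ⟨l x, hl, fun y hy h => h.2 ?_⟩
    rw [abs_lt] at hy
    exact uniformlyHyperbolic_rescale_of_dichotomy h𝒜 hd (by linarith) (by linarith)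
  -- The dimension is measured at a base point; over the empty space every cocycle is hyperbolic.
  rcases isEmpty_or_nonempty M with hempty | ⟨⟨q₀⟩⟩
  · refine ⟨0, eq_empty_of_forall_notMem fun x hx => hx.2 ?_⟩
    exact ⟨fun q => isEmptyElim q, fun q => isEmptyElim q, fun q => isEmptyElim q,
      fun q => isEmptyElim q, continuous_of_const fun q => isEmptyElim q, 1, 1, one_pos, one_pos,
      fun q => isEmptyElim q⟩
  refine exists_hasForm (fun x hx => hx.1) hle hopen
    (fun a => Module.finrank 𝕜 (LinearMap.ker (P a q₀).toLinearMap)) fun x y h1 h2 hxy h3 => ?_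
  have h1y : kappa f 𝒜 < y := h1.trans (EReal.coe_lt_coe_iff.mpr hxy)
  obtain ⟨hlx, hx⟩ := hP x h1 h2
  obtain ⟨hly, hy⟩ := hP y h1y h3
  have hker := hx.ker_le h𝒜 hy (by linarith)
  have hfin : ∀ q, FiniteDimensional 𝕜 (LinearMap.ker (P x q).toLinearMap) :=
    hx.finiteDimensional_ker hM (h1.trans (EReal.coe_lt_coe_iff.mpr (by linarith)))
  refine ⟨Submodule.finrank_mono (hker q₀), fun heq z hz hzS => hzS.2 ?_⟩
  have hker' : ∀ q, LinearMap.ker (P x q).toLinearMap ≤ LinearMap.ker (P y q).toLinearMap :=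
    fun q => by
      refine (Submodule.eq_of_le_of_finrank_eq (hker q) ?_).ge
      -- Equality of dimensions is known only at `q₀`; constancy of the rank carries it to every
      -- `q`.
      rw [Module.finrank, Module.finrank, hx.rank_ker_eq hM q q₀, hy.rank_ker_eq hM q q₀]
      exact heq
  exact uniformlyHyperbolic_rescale_of_dichotomy h𝒜 (hx.join hy hker')
    (by linarith [hz.1]) (by linarith [hz.2])
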